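/- Let $\Delta=\{c\in\mathbb C:|c|<1\}$ and $\overline{\mathbb C}=\mathbb C\cup\{\infty\}$. A holomorphic motion of a set $E\subset\overline{\mathbb C}$ (parametrized by $\Delta$, with base point $0$) is a map $h:\Delta\times E\to\overline{\mathbb C}$ such that $h(0,z)=z$ for all $z\in E$, $h(c,\cdot)$ is injective on $E$ for every $c\in\Delta$, and $c\mapsto h(c,z)$ is holomorphic on $\Delta$ for every $z\in E$. It is normalized if $0,1,\infty\in E$ and $h(c,0)=0$, $h(c,1)=1$, $h(c,\infty)=\infty$ for all $c\in\Delta$. For a normalized motion and $z\in E\setminus\{\infty\}$ put $z(c)=h(c,z)\in\mathbb C$, and let $$V(z(c))=\lim_{c'\to c}\frac{h(c',z)-h(c,z)}{c'-c}$$ be the vector tangent to the motion at the parameter $c$ and the point $z(c)$. Theorem. Let $0<r<1$ and $R>0$. There are constants $M>0$ and $C>0$, depending only on $r$ and $R$, such that for every set $E\subset\overline{\mathbb C}$, every normalized holomorphic motion $h:\Delta\times E\to\overline{\mathbb C}$, all $z_1,z_2\in E\setminus\{\infty\}$ and all $c$ with $|c|\le r$ the following hold. (1) If $0<\delta<1$,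 $|z_1(c)|\le R$, $|z_2(c)|\le R$ and $|z_2(c)-z_1(c)|<\delta$, then, with $\epsilon=\dfrac{M}{\log(1/\delta)}$, $$|V(z_2(c))-V(z_1(c))|\le\frac{2+\epsilon}{1-|c|^2}\,|z_2(c)-z_1(c)|\,\log\frac1{|z_2(c)-z_1(c)|}$$ (the right-hand side is read as $0$ if $z_1(c)=z_2(c)$). (2) If $|z_1(c)|\le R$ and $|z_2(c)|\le R$, then $$|z_2(c)-z_1(c)|\le C\,|z_2-z_1|^{\frac{1-|c|}{1+|c|}}.$$ (3) The inequality in (2) also holds whenever $|z_1|\le R$ and $|z_2|\le R$; that is, $h(c,\cdot)$ is Hölder continuous with exponent $\frac{1-|c|}{1+|c|}$ on $\{z\in E:|z|\le R\}$. -/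

import Mathlib

open Filter Topology

noncomputable section

/-- The point `1 / w` of the Riemann sphere `OnePoint ℂ`, with `1 / 0 = ∞`:
the inverse of the chart `1 / z` around `∞`. -/
def sphereInv (w : ℂ) : OnePoint ℂ :=
  open Classical in if w = 0 then OnePoint.infty else ((w⁻¹ : ℂ) : OnePoint ℂ)

/-- The complex coordinate of a point of the sphere other than `∞` (and `0` at `∞`). -/
def sphereCoord : OnePoint ℂ → ℂ
  | none => 0
  | some w => w

/-- `f` is holomorphic near `c` as a map into the Riemann sphere: near `c` it is a holomorphic
function in one of the two standard charts `z` and `1 / z`. -/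
def HolomorphicIntoSphereAt (f : ℂ → OnePoint ℂ) (c : ℂ) : Prop :=
  (∃ g : ℂ → ℂ, AnalyticAt ℂ g c ∧ f =ᶠ[𝓝 c] fun x => ((g x : ℂ) : OnePoint ℂ)) ∨
  (∃ g : ℂ → ℂ, AnalyticAt ℂ g c ∧ f =ᶠ[𝓝 c] fun x => sphereInv (g x))

/-- `h` is a holomorphic motion of the subset `E` of the Riemann sphere, parametrized by the
unit disk, with base point `0`. (The values of `h` off the unit disk and off `E` play no role.) -/
structure IsHolomorphicMotion (E : Set (OnePoint ℂ)) (h : ℂ → OnePoint ℂ → OnePoint ℂ) :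
    Prop where
  base : ∀ z ∈ E, h 0 z = z
  injOn : ∀ c : ℂ, ‖c‖ < 1 → Set.InjOn (h c) E
  holomorphic : ∀ z ∈ E, ∀ c : ℂ, ‖c‖ < 1 → HolomorphicIntoSphereAt (fun x => h x z) c

/-- A normalized holomorphic motion: `0`, `1`, `∞` lie in `E` and stay fixed. -/
structure IsNormalizedHolomorphicMotion (E : Set (OnePoint ℂ))
    (h : ℂ → OnePoint ℂ → OnePoint ℂ) : Prop extends IsHolomorphicMotion E h where
  zero_mem : ((0 : ℂ) : OnePoint ℂ) ∈ E
  one_mem : ((1 : ℂ) : OnePoint ℂ) ∈ E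
  infty_mem : OnePoint.infty ∈ E
  map_zero : ∀ c : ℂ, ‖c‖ < 1 → h c ((0 : ℂ) : OnePoint ℂ) = ((0 : ℂ) : OnePoint ℂ)
  map_one : ∀ c : ℂ, ‖c‖ < 1 → h c ((1 : ℂ) : OnePoint ℂ) = ((1 : ℂ) : OnePoint ℂ)
  map_infty : ∀ c : ℂ, ‖c‖ < 1 → h c OnePoint.infty = OnePoint.infty

/-- The moving point `z(c) = h(c, z)` that starts at the complex number `z`, as a complex number
(for a normalized motion it is never `∞`, see `coe_movingPoint`). -/
def movingPoint (h : ℂ → OnePoint ℂ → OnePoint ℂ) (z c : ℂ) : ℂ :=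
  sphereCoord (h c (z : OnePoint ℂ))

/-- The value `V(z(c))` at the point `z(c) = h(c, z)` of the vector field tangent to the motion at
the parameter `c`, that is, the limit of `(h(c', z) - h(c, z)) / (c' - c)` as `c' → c`. The limit
exists for normalized motions, see `hasDerivAt_movingPoint`. -/
def tangentVector (h : ℂ → OnePoint ℂ → OnePoint ℂ) (z c : ℂ) : ℂ :=
  deriv (fun c' => movingPoint h z c') c

theorem coe_movingPoint {E : Set (OnePoint ℂ)} {h : ℂ → OnePoint ℂ → OnePoint ℂ}
    (hh : IsNormalizedHolomorphicMotion E h) {z c : ℂ} (hz : (z : OnePoint ℂ) ∈ E)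
    (hc : ‖c‖ < 1) : ((movingPoint h z c : ℂ) : OnePoint ℂ) = h c (z : OnePoint ℂ) := by
  have hne : h c (z : OnePoint ℂ) ≠ OnePoint.infty := by
    intro h0
    rw [← hh.map_infty c hc] at h0
    exact OnePoint.coe_ne_infty z (hh.injOn c hc hz hh.infty_mem h0)
  obtain ⟨w, hw⟩ := OnePoint.ne_infty_iff_exists.1 hne
  unfold movingPoint
  rw [← hw]
  rfl

theorem hasDerivAt_movingPoint {E : Set (OnePoint ℂ)} {h : ℂ → OnePoint ℂ → OnePoint ℂ}
    (hh : IsNormalizedHolomorphicMotion E h) {z c : ℂ} (hz : (z : OnePoint ℂ) ∈ E)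
    (hc : ‖c‖ < 1) : HasDerivAt (movingPoint h z) (tangentVector h z c) c := by
  have key : DifferentiableAt ℂ (movingPoint h z) c := by
    rcases hh.holomorphic _ hz c hc with ⟨g, hg, he⟩ | ⟨g, hg, he⟩
    · refine hg.differentiableAt.congr_of_eventuallyEq ?_
      filter_upwards [he] with x hx
      unfold movingPoint
      rw [hx]
      rfl
    · have hg0 : g c ≠ 0 := by
        intro h0
        have h1 := he.self_of_nhds
        have h2 := coe_movingPoint hh hz hc
        simp only [sphereInv, h0, if_true] at h1
        rw [h1] at h2
        exact OnePoint.coe_ne_infty _ h2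
      refine (hg.differentiableAt.inv hg0).congr_of_eventuallyEq ?_
      filter_upwards [he, hg.continuousAt.eventually_ne hg0] with x hx hx0
      unfold movingPoint
      rw [hx, sphereInv, if_neg hx0]
      rfl
  exact key.hasDerivAt

end

/-! For distinct `z₁`, `z₂` and a fixed point `w` (`0` or `1`) different from both, the quotient
`g(c) = (z₂(c) - z₁(c)) / (w - z₁(c))` is the cross ratio of four points of the motion, so it is
holomorphic on the disk and omits `0` and `1`. Everything follows from Landau's inequality for such
functions, `|g'| (1 - |c|²) ≤ 2|g| (|log |g|| + const)`, whose leading coefficient `2` is that of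
the hyperbolic metric at a puncture.

The inequality (`landau`) comes from Ahlfors' lemma, used twice. Robinson's explicit metric on `ℂ \
{0, 1}` gives a crude bound with a definite constant (`norm_deriv_le_of_omits`). That bound serves
as boundary data on `|w| = 1/2` for a punctured-disk metric on `|w| ≤ 1/2`, which has the right
singularity at `0` (`norm_deriv_le_of_norm_le_half`). Passing to `1/g` covers large values.

Part (1) is Landau's inequality for `g` at `c`, after solving for `V₂ - V₁`
(`norm_tangentVector_sub_le`). For (2), integrating Landau's inequality along a radius gives
`schottky`, where `log |g| + const` grows at most by the factor `(1 + |c|) / (1 - |c|)` between `0`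
and `c`. Applied to `1/g` from `c` back to `0`, this yields the Hölder exponent
(`norm_movingPoint_sub_le`). Part (3) reduces to (2), because Schottky's bound keeps points starting
in `|z| ≤ R` in a larger disk depending only on `r` and `R` (`norm_movingPoint_le`). -/

/-! ### Laplacians of radial functions of holomorphic maps -/

/-- `u` is twice differentiable at `z` along the two coordinate directions, and the sum of the
two second derivatives is `L`. -/
def HasLaplacianAt (u : ℂ → ℝ) (z : ℂ) (L : ℝ) : Prop :=
  ∃ (p q : ℝ → ℝ) (a b : ℝ),
    (∀ᶠ t : ℝ in 𝓝 0, HasDerivAt (fun t : ℝ => u (z + t * 1)) (p t) t) ∧ HasDerivAt p a 0 ∧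
    (∀ᶠ t : ℝ in 𝓝 0, HasDerivAt (fun t : ℝ => u (z + t * Complex.I)) (q t) t) ∧
    HasDerivAt q b 0 ∧ a + b = L

theorem tendsto_line (z e : ℂ) : Tendsto (fun t : ℝ => z + t * e) (𝓝 0) (𝓝 z) := by
  have : ContinuousAt (fun t : ℝ => z + t * e) 0 := by fun_prop
  simpa [ContinuousAt] using this

theorem HasLaplacianAt.add {u v : ℂ → ℝ} {z : ℂ} {L K : ℝ} (hu : HasLaplacianAt u z L)
    (hv : HasLaplacianAt v z K) : HasLaplacianAt (fun x => u x + v x) z (L + K) := by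
  obtain ⟨p, q, a, b, h1, h2, h3, h4, rfl⟩ := hu
  obtain ⟨p', q', a', b', h1', h2', h3', h4', rfl⟩ := hv
  refine ⟨fun t => p t + p' t, fun t => q t + q' t, a + a', b + b', ?_, h2.add h2', ?_, h4.add h4',
    by ring⟩
  · filter_upwards [h1, h1'] with t ht ht' using ht.add ht'
  · filter_upwards [h3, h3'] with t ht ht' using ht.add ht'

theorem hasLaplacianAt_const (k : ℝ) (z : ℂ) : HasLaplacianAt (fun _ => k) z 0 :=
  ⟨fun _ => 0, fun _ => 0, 0, 0, .of_forall fun t => hasDerivAt_const t k, hasDerivAt_const _ _,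
    .of_forall fun t => hasDerivAt_const t k, hasDerivAt_const _ _, by ring⟩

theorem HasLaplacianAt.congr {u v : ℂ → ℝ} {z : ℂ} {L : ℝ} (hu : HasLaplacianAt u z L)
    (h : v =ᶠ[𝓝 z] u) : HasLaplacianAt v z L := by
  obtain ⟨p, q, a, b, h1, h2, h3, h4, rfl⟩ := hu
  have key : ∀ e : ℂ, ∀ᶠ t : ℝ in 𝓝 0,
      (fun t : ℝ => v (z + t * e)) =ᶠ[𝓝 t] fun t : ℝ => u (z + t * e) := fun e =>
    ((tendsto_line z e).eventually h).eventually_nhds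
  refine ⟨p, q, a, b, ?_, h2, ?_, h4, rfl⟩
  · filter_upwards [h1, key 1] with t ht hk using ht.congr_of_eventuallyEq hk
  · filter_upwards [h3, key Complex.I] with t ht hk using ht.congr_of_eventuallyEq hk

/-- A positive second derivative would make `x` a local minimum as well, so `u` would be constant
near `x` and its second derivative zero. -/
theorem second_deriv_nonpos_of_isLocalMax {u p : ℝ → ℝ} {a x : ℝ}
    (h1 : ∀ᶠ t in 𝓝 x, HasDerivAt u (p t) t) (h2 : HasDerivAt p a x) (hm : IsLocalMax u x) :
    a ≤ 0 := by
  by_contra! ha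
  have hd : deriv u =ᶠ[𝓝 x] p := h1.mono fun t ht => ht.deriv
  have hdd : deriv (deriv u) x = a := by rw [hd.deriv_eq, h2.deriv]
  have hmin : IsLocalMin u x :=
    isLocalMin_of_deriv_deriv_pos (hdd ▸ ha) hm.deriv_eq_zero h1.self_of_nhds.continuousAt
  have hconst : u =ᶠ[𝓝 x] fun _ => u x := by
    filter_upwards [hm, hmin] with t h h' using le_antisymm h h'
  have h0 : deriv u =ᶠ[𝓝 x] fun _ => 0 := by
    filter_upwards [hconst.eventuallyEq_nhds] with t ht
    rw [ht.deriv_eq]; simp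
  rw [h0.deriv_eq] at hdd
  simp at hdd
  exact ha.ne hdd

theorem HasLaplacianAt.nonpos_of_isLocalMax {u : ℂ → ℝ} {z : ℂ} {L : ℝ}
    (hu : HasLaplacianAt u z L) (hm : IsLocalMax u z) : L ≤ 0 := by
  obtain ⟨p, q, a, b, h1, h2, h3, h4, rfl⟩ := hu
  have key : ∀ e : ℂ, IsLocalMax (fun t : ℝ => u (z + t * e)) 0 := fun e => by
    have := (tendsto_line z e).eventually hm
    simpa [IsLocalMax, IsMaxFilter] using this
  exact add_nonpos (second_deriv_nonpos_of_isLocalMax h1 h2 (key 1))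
    (second_deriv_nonpos_of_isLocalMax h3 h4 (key Complex.I))

/-- Second derivative of `F (|f|²)` along a line. -/
theorem hasDerivAt_line_comp_normSq {f : ℂ → ℂ} {z : ℂ} (hf : AnalyticAt ℂ f z) {F F₁ : ℝ → ℝ}
    {F₂ : ℝ} (hF : ∀ᶠ s in 𝓝 (Complex.normSq (f z)), HasDerivAt F (F₁ s) s)
    (hF₁ : HasDerivAt F₁ F₂ (Complex.normSq (f z))) (e : ℂ) :
    ∃ p : ℝ → ℝ, (∀ᶠ t : ℝ in 𝓝 0,
        HasDerivAt (fun t : ℝ => F (Complex.normSq (f (z + t * e)))) (p t) t) ∧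
      HasDerivAt p
        (F₂ * (2 * ((f z).re * (deriv f z * e).re + (f z).im * (deriv f z * e).im)) ^ 2 +
        F₁ (Complex.normSq (f z)) * (2 * ((deriv f z * e).re ^ 2 + (deriv f z * e).im ^ 2 +
          (f z).re * (deriv (deriv f) z * e * e).re +
          (f z).im * (deriv (deriv f) z * e * e).im))) 0 := by
  have line : ∀ g : ℂ → ℂ, ∀ t : ℝ, DifferentiableAt ℂ g (z + t * e) →
      HasDerivAt (fun t : ℝ => g (z + t * e)) (deriv g (z + t * e) * e) t := fun g t hg => by
    have h1 : HasDerivAt (fun t : ℝ => z + (t : ℂ) * e) e t := by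
      simpa using ((hasDerivAt_id t).ofReal_comp.mul_const e).const_add z
    exact hg.hasDerivAt.comp t h1
  have re : ∀ (g : ℝ → ℂ) (g' : ℂ) (t : ℝ), HasDerivAt g g' t →
      HasDerivAt (fun t => (g t).re) g'.re t := fun g g' t hg =>
    Complex.reCLM.hasFDerivAt.comp_hasDerivAt t hg
  have im : ∀ (g : ℝ → ℂ) (g' : ℂ) (t : ℝ), HasDerivAt g g' t →
      HasDerivAt (fun t => (g t).im) g'.im t := fun g g' t hg =>
    Complex.imCLM.hasFDerivAt.comp_hasDerivAt t hg
  have nsq : ∀ t : ℝ, DifferentiableAt ℂ f (z + t * e) →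
      HasDerivAt (fun t : ℝ => Complex.normSq (f (z + t * e)))
        (2 * ((f (z + t * e)).re * (deriv f (z + t * e) * e).re +
          (f (z + t * e)).im * (deriv f (z + t * e) * e).im)) t := fun t ht => by
    have h1 := re _ _ _ (line f t ht)
    have h2 := im _ _ _ (line f t ht)
    simp only [Complex.normSq_apply]
    exact ((h1.mul h1).add (h2.mul h2)).congr_deriv (by ring)
  have hcont : Tendsto (fun t : ℝ => Complex.normSq (f (z + t * e))) (𝓝 0)
      (𝓝 (Complex.normSq (f z))) :=
    (Complex.continuous_normSq.tendsto _).comp (hf.continuousAt.tendsto.comp (tendsto_line z e))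
  have hfd : ∀ᶠ t : ℝ in 𝓝 0, DifferentiableAt ℂ f (z + t * e) :=
    (tendsto_line z e).eventually (hf.eventually_analyticAt.mono fun x hx => hx.differentiableAt)
  refine ⟨fun t => F₁ (Complex.normSq (f (z + t * e))) *
    (2 * ((f (z + t * e)).re * (deriv f (z + t * e) * e).re +
          (f (z + t * e)).im * (deriv f (z + t * e) * e).im)), ?_, ?_⟩
  · filter_upwards [hfd, hcont.eventually hF] with t ht hFt
    exact hFt.comp t (nsq t ht)
  · have e0 : z + ((0 : ℝ) : ℂ) * e = z := by simp
    have hf0 : DifferentiableAt ℂ f (z + ((0 : ℝ) : ℂ) * e) := by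
      rw [e0]; exact hf.differentiableAt
    have hf1 : DifferentiableAt ℂ (deriv f) (z + ((0 : ℝ) : ℂ) * e) := by
      rw [e0]; exact hf.deriv.differentiableAt
    have l0 := line f 0 hf0
    have l1 := (line (deriv f) 0 hf1).mul_const e
    have hF₁' : HasDerivAt F₁ F₂ (Complex.normSq (f (z + ((0 : ℝ) : ℂ) * e))) := by rwa [e0]
    have k1 := hF₁'.comp (0 : ℝ) (nsq 0 hf0)
    have k2 := (((re _ _ _ l0).mul (re _ _ _ l1)).add ((im _ _ _ l0).mul (im _ _ _ l1))).const_mul 2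
    refine (k1.mul k2).congr_deriv ?_
    simp only [Function.comp_apply, Pi.add_apply, Pi.mul_apply, e0]
    ring

/-- The terms containing `f''` cancel between the directions `1` and `I`, since `1² + I² = 0`. The
cross terms of the squared first derivatives cancel likewise. -/
theorem HasLaplacianAt.comp_normSq {f : ℂ → ℂ} {z : ℂ} (hf : AnalyticAt ℂ f z) {F F₁ : ℝ → ℝ}
    {F₂ : ℝ} (hF : ∀ᶠ s in 𝓝 (Complex.normSq (f z)), HasDerivAt F (F₁ s) s)
    (hF₁ : HasDerivAt F₁ F₂ (Complex.normSq (f z))) :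
    HasLaplacianAt (fun x => F (Complex.normSq (f x))) z
      (4 * Complex.normSq (deriv f z) *
        (F₁ (Complex.normSq (f z)) + Complex.normSq (f z) * F₂)) := by
  obtain ⟨p, h1, h2⟩ := hasDerivAt_line_comp_normSq hf hF hF₁ 1
  obtain ⟨q, h3, h4⟩ := hasDerivAt_line_comp_normSq hf hF hF₁ Complex.I
  refine ⟨p, q, _, _, h1, h2, h3, h4, ?_⟩
  generalize F₁ (Complex.normSq (f z)) = k
  simp only [Complex.mul_re, Complex.mul_im, Complex.I_re, Complex.I_im, Complex.one_re,
    Complex.one_im, Complex.normSq_apply]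
  ring

theorem hasLaplacianAt_log_norm {f : ℂ → ℂ} {z : ℂ} (hf : AnalyticAt ℂ f z) (h0 : f z ≠ 0) :
    HasLaplacianAt (fun x => Real.log ‖f x‖) z 0 := by
  have hs : 0 < Complex.normSq (f z) := Complex.normSq_pos.2 h0
  have h1 : ∀ᶠ s in 𝓝 (Complex.normSq (f z)),
      HasDerivAt (fun s => Real.log s / 2) (s⁻¹ / 2) s := by
    filter_upwards [lt_mem_nhds hs] with s h
    exact (Real.hasDerivAt_log h.ne').div_const 2
  have h2 : HasDerivAt (fun s : ℝ => s⁻¹ / 2) (-(Complex.normSq (f z) ^ 2)⁻¹ / 2)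
      (Complex.normSq (f z)) := (hasDerivAt_inv hs.ne').div_const 2
  have := HasLaplacianAt.comp_normSq hf h1 h2
  have e : 4 * Complex.normSq (deriv f z) * ((Complex.normSq (f z))⁻¹ / 2 +
      Complex.normSq (f z) * (-(Complex.normSq (f z) ^ 2)⁻¹ / 2)) = 0 := by
    field_simp
    ring
  rw [e] at this
  refine this.congr (.of_forall fun x => ?_)
  simp only [Complex.normSq_eq_norm_sq, Real.log_pow]
  push_cast; ring

/-- The logarithm of the density of a disk of radius `ρ`. -/
theorem hasLaplacianAt_log_sub_sq {ρ : ℝ} {z : ℂ} (hz : ‖z‖ < ρ) :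
    HasLaplacianAt (fun x => Real.log (ρ ^ 2 - ‖x‖ ^ 2)) z
      (-(4 * ρ ^ 2 / (ρ ^ 2 - ‖z‖ ^ 2) ^ 2)) := by
  have hs : Complex.normSq z < ρ ^ 2 := by
    rw [Complex.normSq_eq_norm_sq]; exact pow_lt_pow_left₀ hz (norm_nonneg _) two_ne_zero
  have h1 : ∀ᶠ s in 𝓝 (Complex.normSq z),
      HasDerivAt (fun s => Real.log (ρ ^ 2 - s)) (-1 / (ρ ^ 2 - s)) s := by
    filter_upwards [gt_mem_nhds hs] with s h
    exact ((hasDerivAt_id s).const_sub _).log (sub_pos.2 h).ne'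
  have h2 : HasDerivAt (fun s : ℝ => -1 / (ρ ^ 2 - s)) (-1 / (ρ ^ 2 - Complex.normSq z) ^ 2)
      (Complex.normSq z) :=
    ((hasDerivAt_const _ (-1)).div ((hasDerivAt_id (Complex.normSq z)).const_sub (ρ ^ 2))
      (sub_pos.2 hs).ne').congr_deriv (by simp)
  have := HasLaplacianAt.comp_normSq (f := id) analyticAt_id h1 h2
  have e : 4 * Complex.normSq (deriv id z) * (-1 / (ρ ^ 2 - Complex.normSq (id z)) +
      Complex.normSq (id z) * (-1 / (ρ ^ 2 - Complex.normSq z) ^ 2)) =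
      -(4 * ρ ^ 2 / (ρ ^ 2 - ‖z‖ ^ 2) ^ 2) := by
    have := (sub_pos.2 hs).ne'
    rw [← Complex.normSq_eq_norm_sq]
    simp only [deriv_id, map_one, id]
    field_simp
    ring
  rw [← e]
  refine this.congr (.of_forall fun x => ?_)
  simp only [Complex.normSq_eq_norm_sq, id]

/-! ### Ahlfors' lemma -/

/-- **Ahlfors' lemma** relative to a closed set `A`: a metric `Λ` of curvature at most `-1` in the
interior of `A`, which is dominated by the hyperbolic metric of the disk where `f` is on the
boundary of `A`, is dominated by it wherever `f` is in `A`. -/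
theorem ahlfors_lemma {f : ℂ → ℂ} {A : Set ℂ} {Λ : ℂ → ℝ} (hA : IsClosed A)
    (hf : AnalyticOnNhd ℂ f (Metric.ball 0 1))
    (hΛc : ∀ z ∈ Metric.ball (0 : ℂ) 1, f z ∈ A → ContinuousAt Λ (f z))
    (hΛ : ∀ z ∈ Metric.ball (0 : ℂ) 1, f z ∈ A → 0 < Λ (f z))
    (hcurv : ∀ z ∈ Metric.ball (0 : ℂ) 1, f z ∈ interior A → deriv f z ≠ 0 →
      ∃ L, (Λ (f z) * ‖deriv f z‖) ^ 2 ≤ L ∧ HasLaplacianAt (fun x => Real.log (Λ (f x))) z L)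
    (hbd : ∀ z ∈ Metric.ball (0 : ℂ) 1, f z ∈ A → f z ∉ interior A →
      Λ (f z) * ‖deriv f z‖ * (1 - ‖z‖ ^ 2) ≤ 2) {z : ℂ} (hz : ‖z‖ < 1) (hzA : f z ∈ A) :
    Λ (f z) * ‖deriv f z‖ * (1 - ‖z‖ ^ 2) ≤ 2 := by
  -- Compare with the hyperbolic metric `2ρ / (ρ² - |z|²)` of a smaller disk: the ratio `v` below
  -- then vanishes on `|x| = ρ`, and its maximum over a compact set is attained. Let `ρ → 1` at the
  -- end.
  have main : ∀ ρ : ℝ, ‖z‖ < ρ → ρ < 1 →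
      Λ (f z) * ‖deriv f z‖ * (ρ ^ 2 - ‖z‖ ^ 2) ≤ 2 * ρ := by
    intro ρ hzρ hρ
    have hρ0 : 0 < ρ := (norm_nonneg z).trans_lt hzρ
    have hsub : Metric.closedBall (0 : ℂ) ρ ⊆ Metric.ball 0 1 := Metric.closedBall_subset_ball hρ
    have hfc : ContinuousOn f (Metric.closedBall 0 ρ) := hf.continuousOn.mono hsub
    set K : Set ℂ := Metric.closedBall (0 : ℂ) ρ ∩ f ⁻¹' A with hK
    have hKc : IsCompact K :=
      (isCompact_closedBall (0 : ℂ) ρ).of_isClosed_subset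
        (hfc.preimage_isClosed_of_isClosed Metric.isClosed_closedBall hA) Set.inter_subset_left
    let v : ℂ → ℝ := fun x => Λ (f x) * ‖deriv f x‖ * (ρ ^ 2 - ‖x‖ ^ 2)
    have hvc : ContinuousOn v K := by
      intro x hx
      have hx1 := hsub hx.1
      have c1 : ContinuousAt (fun x => Λ (f x)) x :=
        ContinuousAt.comp (hΛc x hx1 hx.2) (hf x hx1).continuousAt
      have c2 : ContinuousAt (deriv f) x := (hf x hx1).deriv.continuousAt
      exact ((c1.mul c2.norm).mul
        (continuousAt_const.sub (continuousAt_id.norm.pow 2))).continuousWithinAt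
    have hzK : z ∈ K := ⟨by simpa using hzρ.le, hzA⟩
    obtain ⟨w, hw, hmax⟩ := hKc.exists_isMaxOn ⟨z, hzK⟩ hvc
    refine (hmax hzK).trans ?_
    change Λ (f w) * ‖deriv f w‖ * (ρ ^ 2 - ‖w‖ ^ 2) ≤ 2 * ρ
    have hw1 := hsub hw.1
    have hwρ : ‖w‖ ≤ ρ := by simpa using hw.1
    have hΛw := hΛ w hw1 hw.2
    have hm0 : 0 ≤ Λ (f w) * ‖deriv f w‖ := mul_nonneg hΛw.le (norm_nonneg _)
    rcases hwρ.eq_or_lt with h | hwρ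
    · rw [h]; simp [hρ0.le]
    by_cases hint : f w ∈ interior A
    swap
    · have := hbd w hw1 hw.2 hint
      have h2 : ρ ^ 2 - ‖w‖ ^ 2 ≤ ρ * (1 - ‖w‖ ^ 2) := by
        nlinarith [mul_nonneg (sub_nonneg.2 hρ.le) (sq_nonneg ‖w‖)]
      calc _ ≤ Λ (f w) * ‖deriv f w‖ * (ρ * (1 - ‖w‖ ^ 2)) := mul_le_mul_of_nonneg_left h2 hm0
        _ = ρ * (Λ (f w) * ‖deriv f w‖ * (1 - ‖w‖ ^ 2)) := by ring
        _ ≤ ρ * 2 := mul_le_mul_of_nonneg_left this hρ0.le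
        _ = _ := by ring
    by_cases hd : deriv f w = 0
    · simp [hd, hρ0.le]
    have hpos : 0 < ρ ^ 2 - ‖w‖ ^ 2 :=
      sub_pos.2 (pow_lt_pow_left₀ hwρ (norm_nonneg _) two_ne_zero)
    obtain ⟨L, hL, hLap⟩ := hcurv w hw1 hint hd
    -- At an interior maximum the Laplacian of `log v` is nonpositive. As `log |f'|` is harmonic,
    -- this reads `L ≤ 4ρ² / (ρ² - |w|²)²`, which with the curvature bound is the claim squared.
    have hlap := (hLap.add (hasLaplacianAt_log_norm (hf w hw1).deriv hd)).add
      (hasLaplacianAt_log_sub_sq hwρ)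
    have hnear : ∀ᶠ x in 𝓝 w, v x ≤ v w ∧ f x ∈ A ∧ x ∈ Metric.ball (0 : ℂ) ρ ∧
        deriv f x ≠ 0 := by
      have e1 : ∀ᶠ x in 𝓝 w, f x ∈ interior A :=
        (hf w hw1).continuousAt.eventually_mem (isOpen_interior.mem_nhds hint)
      have e2 : ∀ᶠ x in 𝓝 w, x ∈ Metric.ball (0 : ℂ) ρ :=
        Metric.isOpen_ball.mem_nhds (by simpa using hwρ)
      have e3 : ∀ᶠ x in 𝓝 w, deriv f x ≠ 0 := (hf w hw1).deriv.continuousAt.eventually_ne hd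
      filter_upwards [e1, e2, e3] with x h1 h2 h3
      exact ⟨hmax ⟨Metric.ball_subset_closedBall h2, Set.mem_preimage.2 (interior_subset h1)⟩,
        interior_subset h1, h2, h3⟩
    have hlog : ∀ x, f x ∈ A → x ∈ Metric.ball (0 : ℂ) ρ → deriv f x ≠ 0 → 0 < v x ∧
        Real.log (Λ (f x)) + Real.log ‖deriv f x‖ + Real.log (ρ ^ 2 - ‖x‖ ^ 2) =
          Real.log (v x) := by
      intro x h1 h2 h3
      have hx1 := hsub (Metric.ball_subset_closedBall h2)
      have p1 := hΛ x hx1 h1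
      have p2 : 0 < ‖deriv f x‖ := norm_pos_iff.2 h3
      have p3 : 0 < ρ ^ 2 - ‖x‖ ^ 2 :=
        sub_pos.2 (pow_lt_pow_left₀ (by simpa using h2) (norm_nonneg _) two_ne_zero)
      refine ⟨by positivity, ?_⟩
      rw [← Real.log_mul p1.ne' p2.ne', ← Real.log_mul (by positivity) p3.ne']
    have hle := hlap.nonpos_of_isLocalMax (by
      obtain ⟨-, a1, a2, a3⟩ := hnear.self_of_nhds
      filter_upwards [hnear] with x ⟨h0, h1, h2, h3⟩
      rw [(hlog x h1 h2 h3).2, (hlog w a1 a2 a3).2]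
      exact Real.log_le_log (hlog x h1 h2 h3).1 h0)
    have h4 : (Λ (f w) * ‖deriv f w‖) ^ 2 ≤ (2 * ρ / (ρ ^ 2 - ‖w‖ ^ 2)) ^ 2 := by
      rw [div_pow, mul_pow 2 ρ]; norm_num; linarith
    have h5 := (pow_le_pow_iff_left₀ hm0 (by positivity) two_ne_zero).1 h4
    exact (le_div_iff₀ hpos).1 h5
  have t : Tendsto (fun ρ : ℝ => Λ (f z) * ‖deriv f z‖ * (ρ ^ 2 - ‖z‖ ^ 2)) (𝓝[<] 1)
      (𝓝 (Λ (f z) * ‖deriv f z‖ * (1 ^ 2 - ‖z‖ ^ 2))) :=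
    (Continuous.tendsto (by fun_prop) 1).mono_left nhdsWithin_le_nhds
  have t' : Tendsto (fun ρ : ℝ => 2 * ρ) (𝓝[<] 1) (𝓝 (2 * 1)) :=
    (Continuous.tendsto (by fun_prop) 1).mono_left nhdsWithin_le_nhds
  have := le_of_tendsto_of_tendsto t t' (by
    filter_upwards [Ioo_mem_nhdsLT hz] with ρ hρ using main ρ hρ.1 hρ.2)
  simpa using this

/-! ### Robinson's metric on the twice punctured plane -/

/-- The radial building block of the logarithm of the Robinson metric, as a function of `|w|²`. -/
noncomputable def robinsonExponent (s : ℝ) : ℝ :=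
  Real.log (1 + s ^ (1 / 6 : ℝ)) / 2 - 5 / 12 * Real.log s

/-- Robinson's metric on `ℂ \ {0, 1}`; its curvature is at most `-1`. -/
noncomputable def robinsonMetric (w : ℂ) : ℝ :=
  Real.exp (robinsonExponent (Complex.normSq w) + robinsonExponent (Complex.normSq (w - 1))) / 54

theorem hasDerivAt_robinsonExponent {s : ℝ} (hs : 0 < s) :
    HasDerivAt robinsonExponent
      ((s ^ (1 / 6 : ℝ) / (12 * (1 + s ^ (1 / 6 : ℝ))) - 5 / 12) / s) s := by
  have hx : 0 < s ^ (1 / 6 : ℝ) := Real.rpow_pos_of_pos hs _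
  have h1 : HasDerivAt (fun s : ℝ => s ^ (1 / 6 : ℝ)) (s ^ (1 / 6 : ℝ) / (6 * s)) s := by
    refine (Real.hasDerivAt_rpow_const (p := 1 / 6) (Or.inl hs.ne')).congr_deriv ?_
    rw [Real.rpow_sub hs, Real.rpow_one]; field_simp
  refine ((((h1.const_add 1).log (by positivity)).div_const 2).sub
    ((Real.hasDerivAt_log hs.ne').const_mul (5 / 12))).congr_deriv ?_
  field_simp
  ring

theorem hasDerivAt_deriv_robinsonExponent {s : ℝ} (hs : 0 < s) :
    HasDerivAt (fun s : ℝ => (s ^ (1 / 6 : ℝ) / (12 * (1 + s ^ (1 / 6 : ℝ))) - 5 / 12) / s)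
      ((s ^ (1 / 6 : ℝ) / (72 * (1 + s ^ (1 / 6 : ℝ)) ^ 2) -
        (s ^ (1 / 6 : ℝ) / (12 * (1 + s ^ (1 / 6 : ℝ))) - 5 / 12)) / s ^ 2) s := by
  have hx : 0 < s ^ (1 / 6 : ℝ) := Real.rpow_pos_of_pos hs _
  have h1 : HasDerivAt (fun s : ℝ => s ^ (1 / 6 : ℝ)) (s ^ (1 / 6 : ℝ) / (6 * s)) s := by
    refine (Real.hasDerivAt_rpow_const (p := 1 / 6) (Or.inl hs.ne')).congr_deriv ?_
    rw [Real.rpow_sub hs, Real.rpow_one]; field_simp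
  refine (((h1.div ((h1.const_add 1).const_mul 12) (by positivity)).sub_const (5 / 12)).div
    (hasDerivAt_id s) hs.ne').congr_deriv ?_
  simp only [id, Pi.div_apply]
  field_simp
  ring

theorem hasLaplacianAt_robinsonExponent {f : ℂ → ℂ} {z : ℂ} (hf : AnalyticAt ℂ f z)
    (h0 : f z ≠ 0) {X : ℝ} (hX : 0 < X) (hXf : X ^ 3 = ‖f z‖) :
    HasLaplacianAt (fun x => robinsonExponent (Complex.normSq (f x))) z
      (‖deriv f z‖ ^ 2 * (1 / (18 * X ^ 5 * (1 + X) ^ 2))) := by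
  have hs : 0 < Complex.normSq (f z) := Complex.normSq_pos.2 h0
  have hsX : Complex.normSq (f z) = X ^ 6 := by
    rw [Complex.normSq_eq_norm_sq, ← hXf]; ring
  have hX6 : Complex.normSq (f z) ^ (1 / 6 : ℝ) = X := by
    rw [hsX, ← Real.rpow_natCast, ← Real.rpow_mul hX.le]; norm_num
  have h1 : ∀ᶠ s in 𝓝 (Complex.normSq (f z)), HasDerivAt robinsonExponent
      ((s ^ (1 / 6 : ℝ) / (12 * (1 + s ^ (1 / 6 : ℝ))) - 5 / 12) / s) s := by
    filter_upwards [lt_mem_nhds hs] with s h using hasDerivAt_robinsonExponent h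
  have h2 := HasLaplacianAt.comp_normSq hf h1 (hasDerivAt_deriv_robinsonExponent hs)
  convert h2 using 1
  rw [hX6, hsX, ← Complex.normSq_eq_norm_sq]
  field_simp
  ring

/-- With `X = |w|^(1/3)` and `Y = |w - 1|^(1/3)` this is the curvature condition for Robinson's
metric, where `2916 = 54²`. The summand of the smaller variable alone suffices, because the larger
variable is at least `1/2`. -/
theorem robinson_curvature_bound {X Y : ℝ} (hX : 0 < X) (hY : 0 < Y) (h : 1 ≤ X ^ 3 + Y ^ 3) :
    (1 + X) * (1 + Y) / (2916 * (X ^ 5 * Y ^ 5)) ≤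
      1 / (18 * X ^ 5 * (1 + X) ^ 2) + 1 / (18 * Y ^ 5 * (1 + Y) ^ 2) := by
  wlog hXY : X ≤ Y generalizing X Y
  · have := this hY hX (by linarith) (le_of_not_ge hXY)
    rw [add_comm (1 / _), mul_comm (1 + X), mul_comm (X ^ 5)]
    exact this
  have hY2 : 1 / 2 ≤ Y := by
    by_contra! hlt
    have h1 : Y ^ 3 < (1 / 2) ^ 3 := pow_lt_pow_left₀ hlt hY.le (by norm_num)
    have h2 : X ^ 3 ≤ Y ^ 3 := pow_le_pow_left₀ hX.le hXY 3
    norm_num at h1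
    linarith
  -- `1 + Y ≤ 3Y` and `1 ≤ 2Y`, so the left side is at most `81 Y⁴ ≤ 162 Y⁵`. The normalization `54`
  -- fits this: `54² / 18 = 162`.
  have h3 : (1 + Y) ^ 4 ≤ 162 * Y ^ 5 := by
    have h31 : (1 + Y) ^ 4 ≤ (3 * Y) ^ 4 := pow_le_pow_left₀ (by positivity) (by linarith) 4
    nlinarith [mul_nonneg (pow_nonneg hY.le 4) (sub_nonneg.2 hY2)]
  have h4 : (1 + X) ^ 3 * (1 + Y) ≤ (1 + Y) ^ 4 := by
    have : (1 + X) ^ 3 ≤ (1 + Y) ^ 3 := pow_le_pow_left₀ (by positivity) (by linarith) 3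
    calc _ ≤ (1 + Y) ^ 3 * (1 + Y) := mul_le_mul_of_nonneg_right this (by positivity)
      _ = _ := by ring
  have h5 : (1 + X) * (1 + Y) / (2916 * (X ^ 5 * Y ^ 5)) ≤ 1 / (18 * X ^ 5 * (1 + X) ^ 2) := by
    rw [div_le_div_iff₀ (by positivity) (by positivity)]
    have h6 := mul_le_mul_of_nonneg_left (h4.trans h3) (show 0 ≤ 18 * X ^ 5 by positivity)
    calc _ = 18 * X ^ 5 * ((1 + X) ^ 3 * (1 + Y)) := by ring
      _ ≤ _ := h6
      _ = _ := by ring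
  exact h5.trans (le_add_of_nonneg_right (by positivity))

theorem exp_two_mul_robinsonExponent {X : ℝ} (hX : 0 < X) :
    Real.exp (robinsonExponent (X ^ 6)) ^ 2 = (1 + X) / X ^ 5 := by
  have hX6 : (X ^ 6) ^ (1 / 6 : ℝ) = X := by
    rw [← Real.rpow_natCast, ← Real.rpow_mul hX.le]; norm_num
  have e : ((2 : ℕ) : ℝ) * robinsonExponent (X ^ 6) = Real.log (1 + X) - Real.log (X ^ 5) := by
    rw [robinsonExponent, hX6, Real.log_pow, Real.log_pow]
    push_cast; ring
  rw [← Real.exp_nat_mul, e, Real.exp_sub, Real.exp_log (by positivity),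
    Real.exp_log (by positivity)]

theorem robinsonMetric_curvature {f : ℂ → ℂ} {z : ℂ} (hf : AnalyticAt ℂ f z) (h0 : f z ≠ 0)
    (h1 : f z ≠ 1) : ∃ L, (robinsonMetric (f z) * ‖deriv f z‖) ^ 2 ≤ L ∧
      HasLaplacianAt (fun x => Real.log (robinsonMetric (f x))) z L := by
  have cube : ∀ a : ℝ, 0 < a → ∃ X : ℝ, 0 < X ∧ X ^ 3 = a := fun a ha =>
    ⟨a ^ (1 / 3 : ℝ), Real.rpow_pos_of_pos ha _, by
      rw [← Real.rpow_natCast, ← Real.rpow_mul ha.le]; norm_num⟩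
  obtain ⟨X, hX, hXf⟩ := cube _ (norm_pos_iff.2 h0)
  obtain ⟨Y, hY, hYf⟩ := cube _ (norm_pos_iff.2 (sub_ne_zero.2 h1))
  have hd : deriv (fun x => f x - 1) z = deriv f z := deriv_sub_const _
  have l1 := hasLaplacianAt_robinsonExponent hf h0 hX hXf
  have l2 := hasLaplacianAt_robinsonExponent (f := fun x => f x - 1) (hf.sub analyticAt_const)
    (sub_ne_zero.2 h1) hY hYf
  rw [hd] at l2
  refine ⟨_, ?_, ((l1.add l2).add (hasLaplacianAt_const (-Real.log 54) z)).congr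
    (.of_forall fun x => ?_)⟩
  · have e : ∀ w : ℂ, ∀ X : ℝ, X ^ 3 = ‖w‖ → Complex.normSq w = X ^ 6 := fun w X h => by
      rw [Complex.normSq_eq_norm_sq, ← h]; ring
    have tri : 1 ≤ X ^ 3 + Y ^ 3 := by
      rw [hXf, hYf]
      calc (1 : ℝ) = ‖f z - (f z - 1)‖ := by simp
        _ ≤ _ := norm_sub_le _ _
    have key := mul_le_mul_of_nonneg_left (robinson_curvature_bound hX hY tri)
      (sq_nonneg ‖deriv f z‖)
    rw [robinsonMetric, e _ X hXf, e _ Y hYf, Real.exp_add, mul_pow, div_pow, mul_pow,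
      exp_two_mul_robinsonExponent hX, exp_two_mul_robinsonExponent hY]
    calc _ = ‖deriv f z‖ ^ 2 * ((1 + X) * (1 + Y) / (2916 * (X ^ 5 * Y ^ 5))) := by
          field_simp; norm_num; ring
      _ ≤ _ := key
      _ = _ := by ring
  · simp only [robinsonMetric]
    rw [Real.log_div (Real.exp_pos _).ne' (by norm_num), Real.log_exp, sub_eq_add_neg]

/-- Dropping the nonnegative `log (1 + ·)` terms leaves `(|w| |w - 1|)^(-5/6) / 54`, and `m^(-5/6) ≥
1/m` for `m ≥ 1`. This converts a bound in the metric into one for `|f'|`. -/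
theorem le_robinsonMetric {w : ℂ} (h0 : w ≠ 0) (h1 : w ≠ 1) {m : ℝ} (hm : 1 ≤ m)
    (h : ‖w‖ * ‖w - 1‖ ≤ m) : 1 / (54 * m) ≤ robinsonMetric w := by
  have p0 := norm_pos_iff.2 h0
  have p1 := norm_pos_iff.2 (sub_ne_zero.2 h1)
  have low : ∀ v : ℂ, -(5 / 6) * Real.log ‖v‖ ≤ robinsonExponent (Complex.normSq v) := by
    intro v
    have : 0 ≤ Real.log (1 + Complex.normSq v ^ (1 / 6 : ℝ)) :=
      Real.log_nonneg (by have := Real.rpow_nonneg (Complex.normSq_nonneg v) (1 / 6); linarith)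
    rw [robinsonExponent, Complex.normSq_eq_norm_sq v, Real.log_pow,
      ← Complex.normSq_eq_norm_sq v]
    push_cast
    linarith
  have hl : Real.log ‖w‖ + Real.log ‖w - 1‖ ≤ Real.log m := by
    rw [← Real.log_mul p0.ne' p1.ne']
    exact Real.log_le_log (by positivity) h
  have hm0 := Real.log_nonneg hm
  have hE : -Real.log m ≤ robinsonExponent (Complex.normSq w) +
      robinsonExponent (Complex.normSq (w - 1)) := by
    linarith [low w, low (w - 1)]
  have := Real.exp_le_exp.2 hE
  rw [Real.exp_neg, Real.exp_log (by linarith)] at this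
  rw [robinsonMetric, one_div, mul_inv_rev, div_eq_mul_inv]
  exact mul_le_mul_of_nonneg_right this (by norm_num)

theorem continuousAt_robinsonMetric {w : ℂ} (h0 : w ≠ 0) (h1 : w ≠ 1) :
    ContinuousAt robinsonMetric w := by
  have c0 : ContinuousAt (fun w => robinsonExponent (Complex.normSq w)) w :=
    ContinuousAt.comp (hasDerivAt_robinsonExponent (Complex.normSq_pos.2 h0)).continuousAt
      Complex.continuous_normSq.continuousAt
  have c1 : ContinuousAt (fun w => robinsonExponent (Complex.normSq (w - 1))) w :=
    ContinuousAt.comp (f := fun w => Complex.normSq (w - 1))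
      (hasDerivAt_robinsonExponent (Complex.normSq_pos.2 (sub_ne_zero.2 h1))).continuousAt
      (Complex.continuous_normSq.comp (continuous_id.sub continuous_const)).continuousAt
  exact (Real.continuous_exp.continuousAt.comp (c0.add c1)).div_const _

theorem norm_deriv_le_of_omits {f : ℂ → ℂ} (hf : AnalyticOnNhd ℂ f (Metric.ball 0 1))
    (h0 : ∀ z ∈ Metric.ball (0 : ℂ) 1, f z ≠ 0) (h1 : ∀ z ∈ Metric.ball (0 : ℂ) 1, f z ≠ 1)
    {z : ℂ} (hz : ‖z‖ < 1) {m : ℝ} (hm : 1 ≤ m) (h : ‖f z‖ * ‖f z - 1‖ ≤ m) :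
    ‖deriv f z‖ * (1 - ‖z‖ ^ 2) ≤ 108 * m := by
  have hzb : z ∈ Metric.ball (0 : ℂ) 1 := by simpa using hz
  have key := ahlfors_lemma (A := Set.univ) (Λ := robinsonMetric) isClosed_univ hf
    (fun z hz _ => continuousAt_robinsonMetric (h0 z hz) (h1 z hz))
    (fun z hz _ => by rw [robinsonMetric]; positivity)
    (fun z hz _ _ => robinsonMetric_curvature (hf z hz) (h0 z hz) (h1 z hz))
    (fun z _ _ h => absurd (by simp) h) hz (Set.mem_univ _)
  have hlow := le_robinsonMetric (h0 z hzb) (h1 z hzb) hm h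
  have hz2 : 0 ≤ 1 - ‖z‖ ^ 2 := by nlinarith [norm_nonneg z]
  have := (mul_le_mul_of_nonneg_right hlow (mul_nonneg (norm_nonneg (deriv f z)) hz2)).trans
    ((mul_assoc _ _ _).symm.le.trans key)
  rw [one_div, inv_mul_le_iff₀ (by positivity)] at this
  linarith

/-! ### Sharp behaviour at the puncture -/

/-- The hyperbolic metric of a punctured disk, in which `0` is a puncture. -/
theorem punctured_disk_curvature {f : ℂ → ℂ} {z : ℂ} {c : ℝ} (hf : AnalyticAt ℂ f z)
    (h0 : f z ≠ 0) (hc : Real.log ‖f z‖ < c) :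
    HasLaplacianAt (fun x => Real.log (1 / (‖f x‖ * (c - Real.log ‖f x‖)))) z
      ((1 / (‖f z‖ * (c - Real.log ‖f z‖)) * ‖deriv f z‖) ^ 2) := by
  have hs : 0 < Complex.normSq (f z) := Complex.normSq_pos.2 h0
  have hlog : ∀ w : ℂ, Real.log (Complex.normSq w) = 2 * Real.log ‖w‖ := fun w => by
    rw [Complex.normSq_eq_norm_sq, Real.log_pow]; norm_num
  have hev : ∀ᶠ s in 𝓝 (Complex.normSq (f z)), 0 < s ∧ 0 < c - Real.log s / 2 := by
    have c1 : ContinuousAt (fun s => c - Real.log s / 2) (Complex.normSq (f z)) :=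
      continuousAt_const.sub ((Real.continuousAt_log hs.ne').div_const 2)
    have h2 : 0 < c - Real.log (Complex.normSq (f z)) / 2 := by rw [hlog]; linarith
    exact (lt_mem_nhds hs).and (c1.eventually (lt_mem_nhds h2))
  have d0 : ∀ s : ℝ, 0 < s → HasDerivAt (fun s => c - Real.log s / 2) (-(s⁻¹ / 2)) s :=
    fun s h => ((Real.hasDerivAt_log h.ne').div_const 2).const_sub c
  have h1 : ∀ᶠ s in 𝓝 (Complex.normSq (f z)),
      HasDerivAt (fun s => -Real.log (c - Real.log s / 2))
        (1 / (2 * s * (c - Real.log s / 2))) s := by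
    filter_upwards [hev] with s ⟨h, h'⟩
    refine ((d0 s h).log h'.ne').neg.congr_deriv ?_
    generalize c - Real.log s / 2 = l at *
    field_simp
  obtain ⟨-, hl⟩ := hev.self_of_nhds
  have h2 : HasDerivAt (fun s => 1 / (2 * s * (c - Real.log s / 2)))
      ((1 - 2 * (c - Real.log ‖f z‖)) / (2 * ‖f z‖ ^ 2 * (c - Real.log ‖f z‖)) ^ 2)
      (Complex.normSq (f z)) := by
    refine ((hasDerivAt_const _ (1 : ℝ)).div (((hasDerivAt_id _).const_mul 2).mul (d0 _ hs))
      (mul_pos (mul_pos two_pos hs) hl).ne').congr_deriv ?_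
    have e : c - Real.log (Complex.normSq (f z)) / 2 = c - Real.log ‖f z‖ := by rw [hlog]; ring
    simp only [Pi.mul_apply, e]
    rw [Complex.normSq_eq_norm_sq]
    field_simp
    ring
  -- The logarithm of the density is `log |1/f| - log (c - log |f|)`. The first term is harmonic, so
  -- only the second contributes.
  have l1 := HasLaplacianAt.comp_normSq hf h1 h2
  have l2 := hasLaplacianAt_log_norm (hf.inv h0) (inv_ne_zero h0)
  have hl' : 0 < c - Real.log ‖f z‖ := sub_pos.2 hc
  have hn : 0 < ‖f z‖ := norm_pos_iff.2 h0
  convert (l2.add l1).congr (v := fun x => Real.log (1 / (‖f x‖ * (c - Real.log ‖f x‖)))) ?_ using 1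
  · rw [hlog, Complex.normSq_eq_norm_sq, Complex.normSq_eq_norm_sq,
      show c - 2 * Real.log ‖f z‖ / 2 = c - Real.log ‖f z‖ by ring]
    field_simp
    ring
  · have hev' := (Complex.continuous_normSq.continuousAt.comp hf.continuousAt).eventually hev
    filter_upwards [hev'] with x ⟨hx, hx'⟩
    simp only [Function.comp_apply] at hx hx'
    rw [hlog] at hx' ⊢
    have hx0 : 0 < ‖f x‖ := norm_pos_iff.2 (Complex.normSq_pos.1 hx)
    rw [mul_div_cancel_left₀ _ two_ne_zero] at hx' ⊢
    rw [Real.log_div one_ne_zero (by positivity), Real.log_mul hx0.ne' hx'.ne', Pi.inv_apply,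
      norm_inv, Real.log_inv, Real.log_one]
    ring

/-- Ahlfors' lemma relative to `|w| ≤ 1/2`. On `|w| = 1/2` one has `|w| |w - 1| ≤ 3/4`, so the crude
bound `108` holds there; the constant in `108 - log |w|` is chosen so that this bound gives the
required domination. -/
theorem norm_deriv_le_of_norm_le_half {f : ℂ → ℂ} (hf : AnalyticOnNhd ℂ f (Metric.ball 0 1))
    (h0 : ∀ z ∈ Metric.ball (0 : ℂ) 1, f z ≠ 0) (h1 : ∀ z ∈ Metric.ball (0 : ℂ) 1, f z ≠ 1)
    {z : ℂ} (hz : ‖z‖ < 1) (h : ‖f z‖ ≤ 1 / 2) :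
    ‖deriv f z‖ * (1 - ‖z‖ ^ 2) ≤ 2 * ‖f z‖ * (108 - Real.log ‖f z‖) := by
  have hpos : ∀ w ∈ Metric.ball (0 : ℂ) 1, f w ∈ Metric.closedBall (0 : ℂ) (1 / 2) →
      0 < ‖f w‖ ∧ Real.log ‖f w‖ ≤ 0 := fun w hw hA => by
    have : ‖f w‖ ≤ 1 / 2 := by simpa using hA
    exact ⟨norm_pos_iff.2 (h0 w hw), Real.log_nonpos (norm_nonneg _) (by linarith)⟩
  have key := ahlfors_lemma (A := Metric.closedBall 0 (1 / 2))
    (Λ := fun w => 1 / (‖w‖ * (108 - Real.log ‖w‖))) Metric.isClosed_closedBall hf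
    (fun w hw hA => by
      obtain ⟨p1, p2⟩ := hpos w hw hA
      have c1 : ContinuousAt (fun w : ℂ => ‖w‖) (f w) := continuous_norm.continuousAt
      exact continuousAt_const.div (c1.mul (continuousAt_const.sub (c1.log p1.ne')))
        (mul_pos p1 (by linarith)).ne')
    (fun w hw hA => by
      obtain ⟨p1, p2⟩ := hpos w hw hA
      exact one_div_pos.2 (mul_pos p1 (by linarith)))
    (fun w hw hA _ => by
      obtain ⟨p1, p2⟩ := hpos w hw (interior_subset hA)
      exact ⟨_, le_rfl, punctured_disk_curvature (hf w hw) (h0 w hw) (by linarith)⟩)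
    (fun w hw hA hA' => by
      have e : ‖f w‖ = 1 / 2 := by
        rw [interior_closedBall _ (by norm_num)] at hA'
        simp only [mem_closedBall_zero_iff, mem_ball_zero_iff, not_lt] at hA hA'
        exact le_antisymm hA hA'
      have hw1 : ‖w‖ < 1 := by simpa using hw
      have h2 : ‖f w - 1‖ ≤ 3 / 2 := (norm_sub_le _ _).trans (by rw [e, norm_one]; norm_num)
      have := norm_deriv_le_of_omits hf h0 h1 hw1 le_rfl (by rw [e]; linarith)
      have hl : 0 ≤ Real.log 2 := Real.log_nonneg (by norm_num)
      rw [mul_assoc, e, one_div, Real.log_div one_ne_zero two_ne_zero, Real.log_one,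
        inv_mul_le_iff₀ (by linarith)]
      linarith)
    hz (by simpa using h)
  obtain ⟨p1, p2⟩ := hpos z (by simpa using hz) (by simpa using h)
  rw [mul_assoc, one_div, inv_mul_le_iff₀ (mul_pos p1 (by linarith))] at key
  linarith

/-! ### The theorems of Landau and Schottky -/

/-- **Landau's theorem** with the sharp constant at the punctures: a bound for the derivative of a
holomorphic function that omits `0` and `1`. -/
theorem landau {f : ℂ → ℂ} (hf : AnalyticOnNhd ℂ f (Metric.ball 0 1))
    (h0 : ∀ z ∈ Metric.ball (0 : ℂ) 1, f z ≠ 0) (h1 : ∀ z ∈ Metric.ball (0 : ℂ) 1, f z ≠ 1)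
    {z : ℂ} (hz : ‖z‖ < 1) :
    ‖deriv f z‖ * (1 - ‖z‖ ^ 2) ≤ 2 * ‖f z‖ * (|Real.log ‖f z‖| + 648) := by
  have hzb : z ∈ Metric.ball (0 : ℂ) 1 := by simpa using hz
  have p := norm_pos_iff.2 (h0 z hzb)
  rcases le_total ‖f z‖ (1 / 2) with h | h
  · refine (norm_deriv_le_of_norm_le_half hf h0 h1 hz h).trans ?_
    refine mul_le_mul_of_nonneg_left ?_ (by positivity)
    linarith [neg_le_abs (Real.log ‖f z‖)]
  -- Away from the punctures the crude bound with `m = 6` suffices: `108 * 6 = 648 ≤ 2|f| * 648`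
  -- when `|f| ≥ 1/2`. For `|f| ≥ 2` use `1/f`, which also omits `0` and `1`.
  rcases le_total ‖f z‖ 2 with h' | h'
  · have h2 : ‖f z - 1‖ ≤ 3 := (norm_sub_le _ _).trans (by rw [norm_one]; linarith)
    have h6 : ‖f z‖ * ‖f z - 1‖ ≤ 6 := by nlinarith [norm_nonneg (f z - 1)]
    have := norm_deriv_le_of_omits hf h0 h1 hz (by norm_num) h6
    nlinarith [abs_nonneg (Real.log ‖f z‖)]
  · have key := norm_deriv_le_of_norm_le_half (f := fun w => (f w)⁻¹) (hf.inv h0)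
      (fun w hw => inv_ne_zero (h0 w hw)) (fun w hw => by simpa using h1 w hw) hz
      (by rw [norm_inv, one_div]; exact inv_anti₀ two_pos h')
    rw [((hf z hzb).differentiableAt.hasDerivAt.fun_inv (h0 z hzb)).deriv, norm_div, norm_neg,
      norm_pow, norm_inv, Real.log_inv] at key
    have h3 : ‖deriv f z‖ * (1 - ‖z‖ ^ 2) ≤ 2 * ‖f z‖ * (108 - -Real.log ‖f z‖) := by
      have := mul_le_mul_of_nonneg_right key (sq_nonneg ‖f z‖)
      field_simp at this
      linarith
    refine h3.trans (mul_le_mul_of_nonneg_left ?_ (by positivity))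
    linarith [le_abs_self (Real.log ‖f z‖)]

/-- **Schottky's theorem** along a diameter of the disk. -/
theorem schottky {f : ℂ → ℂ} (hf : AnalyticOnNhd ℂ f (Metric.ball 0 1))
    (h0 : ∀ z ∈ Metric.ball (0 : ℂ) 1, f z ≠ 0) (h1 : ∀ z ∈ Metric.ball (0 : ℂ) 1, f z ≠ 1)
    {e : ℂ} (he : ‖e‖ = 1) {a b : ℝ} (ha : -1 < a) (hab : a ≤ b) (hb : b < 1) :
    Real.log ‖f (b * e)‖ + 649 ≤
      (1 + b) / (1 - b) / ((1 + a) / (1 - a)) * (max (Real.log ‖f (a * e)‖) 0 + 649) := by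
  set u : ℝ → ℝ := fun t => Real.log ‖f (t * e)‖ with hu
  set K : ℝ := (max (u a) 0 + 649) / ((1 + a) / (1 - a)) with hK
  have hq : 0 < (1 + a) / (1 - a) := div_pos (by linarith) (by linarith)
  have hK0 : 0 < K := div_pos (by linarith [le_max_right (u a) 0]) hq
  have hmem : ∀ t : ℝ, a ≤ t → t ≤ b → (t : ℂ) * e ∈ Metric.ball (0 : ℂ) 1 := fun t h h' => by
    rw [mem_ball_zero_iff, norm_mul, he, mul_one, Complex.norm_real, Real.norm_eq_abs, abs_lt]
    exact ⟨by linarith, by linarith⟩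
  have hder : ∀ t : ℝ, a ≤ t → t ≤ b → ∃ u', HasDerivAt u u' t ∧
      |u'| * (1 - t ^ 2) ≤ 2 * (|u t| + 648) := by
    intro t h h'
    have hm := hmem t h h'
    have hn := h0 _ hm
    have hnp := norm_pos_iff.2 hn
    have d1 : HasDerivAt (fun t : ℝ => f (t * e)) (deriv f (t * e) * e) t := by
      have : HasDerivAt (fun t : ℝ => (t : ℂ) * e) e t := by
        simpa using (hasDerivAt_id t).ofReal_comp.mul_const e
      exact (hf _ hm).differentiableAt.hasDerivAt.comp t this
    have d2 := d1.norm_sq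
    have d3 := (d2.log (by positivity)).div_const 2
    refine ⟨_, d3.congr_of_eventuallyEq (.of_forall fun s => ?_), ?_⟩
    · simp only [hu, Real.log_pow]; push_cast; ring
    · have l := landau hf h0 h1 (z := t * e) (by simpa using hm)
      rw [show ‖(t : ℂ) * e‖ ^ 2 = t ^ 2 by
        rw [norm_mul, he, mul_one, Complex.norm_real, Real.norm_eq_abs, sq_abs]] at l
      have ht : 0 ≤ 1 - t ^ 2 := by nlinarith
      have i : |inner ℝ (f (t * e)) (deriv f (t * e) * e)| ≤
          ‖f (t * e)‖ * ‖deriv f (t * e)‖ := by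
        have := abs_real_inner_le_norm (f (t * e)) (deriv f (t * e) * e)
        rwa [norm_mul, he, mul_one] at this
      rw [show ∀ x y : ℝ, 2 * x / y / 2 = x / y by intros; ring, abs_div,
        abs_of_nonneg (sq_nonneg ‖f (t * e)‖), div_mul_eq_mul_div, div_le_iff₀ (by positivity)]
      calc _ ≤ ‖f (t * e)‖ * ‖deriv f (t * e)‖ * (1 - t ^ 2) := mul_le_mul_of_nonneg_right i ht
        _ = ‖f (t * e)‖ * (‖deriv f (t * e)‖ * (1 - t ^ 2)) := by ring
        _ ≤ ‖f (t * e)‖ * (2 * ‖f (t * e)‖ * (|Real.log ‖f (t * e)‖| + 648)) :=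
          mul_le_mul_of_nonneg_left l hnp.le
        _ = _ := by ring
  -- The barrier `B = K (1 + t)/(1 - t) - 649` solves `B' (1 - t²) = 2 (B + 649)`. Taking `649`
  -- instead of `648` makes the comparison of derivatives strict where `u` meets `B`.
  have main := image_le_of_deriv_right_lt_deriv_boundary' (f := u) (a := a) (b := b)
    (f' := fun t => deriv u t) (B := fun t => K * ((1 + t) / (1 - t)) - 649)
    (B' := fun t => K * (2 / (1 - t) ^ 2))
    (fun t ht => by
      obtain ⟨u', hu', -⟩ := hder t ht.1 ht.2
      exact hu'.continuousAt.continuousWithinAt)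
    (fun t ht => by
      obtain ⟨u', hu', -⟩ := hder t ht.1 ht.2.le
      rw [hu'.deriv]
      exact hu'.hasDerivWithinAt)
    (by
      rw [hK, div_mul_cancel₀ _ hq.ne']
      linarith [le_max_left (u a) 0])
    (ContinuousOn.sub (continuousOn_const.mul
      ((continuousOn_const.add continuousOn_id).div (continuousOn_const.sub continuousOn_id)
        fun t ht => (sub_pos.2 (ht.2.trans_lt hb)).ne')) continuousOn_const)
    (fun t ht => by
      have ht1 : 1 - t ≠ 0 := (sub_pos.2 (ht.2.trans hb)).ne'
      refine HasDerivAt.hasDerivWithinAt ?_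
      refine (((((hasDerivAt_id t).const_add 1).div ((hasDerivAt_id t).const_sub 1)
        ht1).const_mul K).sub_const 649).congr_deriv ?_
      simp only [id]
      ring)
    (fun t ht htB => by
      obtain ⟨u', hu', hle⟩ := hder t ht.1 ht.2.le
      rw [hu'.deriv]
      have t1 : 0 < 1 - t := by linarith [ht.2]
      have t2 : 0 < 1 + t := by linarith [ht.1]
      have hmono : (1 + a) / (1 - a) ≤ (1 + t) / (1 - t) := by
        rw [div_le_div_iff₀ (by linarith) t1]; nlinarith [ht.1]
      -- The `max` with `0` in `K` keeps the barrier nonnegative, so `|u| = u` at a contact point.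
      have hut : 0 ≤ u t := by
        have := mul_le_mul_of_nonneg_left hmono hK0.le
        have e1 : K * ((1 + a) / (1 - a)) = max (u a) 0 + 649 := div_mul_cancel₀ _ hq.ne'
        rw [htB]
        linarith [le_max_right (u a) 0]
      rw [abs_of_nonneg hut] at hle
      have h3 : u t + 648 < K * ((1 + t) / (1 - t)) := by rw [htB]; linarith
      have h4 : u' * (1 - t ^ 2) < 2 * (K * ((1 + t) / (1 - t))) := by
        have := mul_le_mul_of_nonneg_right (le_abs_self u') (show 0 ≤ 1 - t ^ 2 by nlinarith)
        linarith
      have h5 : K * (2 / (1 - t) ^ 2) * (1 - t ^ 2) = 2 * (K * ((1 + t) / (1 - t))) := by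
        field_simp; ring
      rw [← h5] at h4
      exact lt_of_mul_lt_mul_right h4 (by nlinarith))
  have := main (Set.right_mem_Icc.2 hab)
  calc _ ≤ K * ((1 + b) / (1 - b)) := by linarith
    _ = _ := by rw [hK]; ring

/-! ### Cross ratios of moving points -/

section motion

variable {E : Set (OnePoint ℂ)} {h : ℂ → OnePoint ℂ → OnePoint ℂ}

theorem analyticOnNhd_movingPoint (hh : IsNormalizedHolomorphicMotion E h) {z : ℂ}
    (hz : (z : OnePoint ℂ) ∈ E) : AnalyticOnNhd ℂ (movingPoint h z) (Metric.ball 0 1) :=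
  DifferentiableOn.analyticOnNhd (fun _ hc => (hasDerivAt_movingPoint hh hz
    (by simpa using hc)).differentiableAt.differentiableWithinAt) Metric.isOpen_ball

theorem movingPoint_ne (hh : IsNormalizedHolomorphicMotion E h) {z₁ z₂ c : ℂ}
    (hz₁ : (z₁ : OnePoint ℂ) ∈ E) (hz₂ : (z₂ : OnePoint ℂ) ∈ E) (hc : ‖c‖ < 1) (hne : z₁ ≠ z₂) :
    movingPoint h z₁ c ≠ movingPoint h z₂ c := fun heq => by
  refine hne (OnePoint.coe_injective (hh.injOn c hc hz₁ hz₂ ?_))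
  rw [← coe_movingPoint hh hz₁ hc, ← coe_movingPoint hh hz₂ hc, heq]

theorem movingPoint_zero_right (hh : IsNormalizedHolomorphicMotion E h) {z : ℂ}
    (hz : (z : OnePoint ℂ) ∈ E) : movingPoint h z 0 = z :=
  OnePoint.coe_injective ((coe_movingPoint hh hz (by simp)).trans (hh.base _ hz))

theorem movingPoint_zero_left (hh : IsNormalizedHolomorphicMotion E h) {c : ℂ} (hc : ‖c‖ < 1) :
    movingPoint h 0 c = 0 := by
  rw [movingPoint, hh.map_zero c hc]; rfl

theorem movingPoint_one_left (hh : IsNormalizedHolomorphicMotion E h) {c : ℂ} (hc : ‖c‖ < 1) :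
    movingPoint h 1 c = 1 := by
  rw [movingPoint, hh.map_one c hc]; rfl

theorem tangentVector_eq_zero {w c : ℂ} (hc : ‖c‖ < 1)
    (hw : ∀ c : ℂ, ‖c‖ < 1 → movingPoint h w c = w) : tangentVector h w c = 0 := by
  have : movingPoint h w =ᶠ[𝓝 c] fun _ => w := by
    filter_upwards [Metric.isOpen_ball.mem_nhds (show c ∈ Metric.ball (0 : ℂ) 1 by simpa using hc)]
      with x hx using hw x (by simpa using hx)
  exact this.deriv_eq.trans (deriv_const _ _)

/-- One of the fixed points `0` and `1` is far from a given point. -/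
theorem exists_fixed_far (hh : IsNormalizedHolomorphicMotion E h) (v : ℂ) :
    ∃ w : ℂ, (w : OnePoint ℂ) ∈ E ∧ (∀ c : ℂ, ‖c‖ < 1 → movingPoint h w c = w) ∧ ‖w‖ ≤ 1 ∧
      1 / 2 ≤ ‖w - v‖ := by
  rcases le_total (1 / 2) ‖v‖ with hv | hv
  · exact ⟨0, hh.zero_mem, fun c hc => movingPoint_zero_left hh hc, by simp, by simpa using hv⟩
  · refine ⟨1, hh.one_mem, fun c hc => movingPoint_one_left hh hc, by simp, ?_⟩
    have := norm_sub_norm_le (1 : ℂ) v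
    rw [norm_one] at this
    linarith

/-- The cross ratio of three moving points and `∞` omits `0` and `1`. -/
theorem movingPoint_ratio (hh : IsNormalizedHolomorphicMotion E h) {z₁ z₂ w : ℂ}
    (hz₁ : (z₁ : OnePoint ℂ) ∈ E) (hz₂ : (z₂ : OnePoint ℂ) ∈ E) (hw : (w : OnePoint ℂ) ∈ E)
    (h12 : z₁ ≠ z₂) (h1w : z₁ ≠ w) (h2w : z₂ ≠ w) {g : ℂ → ℂ}
    (hg : g = fun c => (movingPoint h z₂ c - movingPoint h z₁ c) /
      (movingPoint h w c - movingPoint h z₁ c)) :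
    AnalyticOnNhd ℂ g (Metric.ball 0 1) ∧ (∀ c ∈ Metric.ball (0 : ℂ) 1, g c ≠ 0) ∧
      ∀ c ∈ Metric.ball (0 : ℂ) 1, g c ≠ 1 := by
  have hd : ∀ c ∈ Metric.ball (0 : ℂ) 1, movingPoint h w c - movingPoint h z₁ c ≠ 0 :=
    fun c hc => sub_ne_zero.2 (movingPoint_ne hh hz₁ hw (by simpa using hc) h1w).symm
  subst hg
  refine ⟨((analyticOnNhd_movingPoint hh hz₂).sub (analyticOnNhd_movingPoint hh hz₁)).div
    ((analyticOnNhd_movingPoint hh hw).sub (analyticOnNhd_movingPoint hh hz₁)) hd,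
    fun c hc => div_ne_zero
      (sub_ne_zero.2 (movingPoint_ne hh hz₁ hz₂ (by simpa using hc) h12).symm) (hd c hc),
    fun c hc heq => ?_⟩
  rw [div_eq_one_iff_eq (hd c hc), sub_left_inj] at heq
  exact movingPoint_ne hh hz₂ hw (by simpa using hc) h2w heq

theorem mul_abs_log_le {x : ℝ} (hx : 0 < x) : x * |Real.log x| ≤ 1 + x ^ 2 := by
  rcases le_total x 1 with h1 | h1
  · rw [abs_of_nonpos (Real.log_nonpos hx.le h1), ← Real.log_inv]
    have := mul_le_mul_of_nonneg_left (Real.log_le_self (inv_pos.2 hx).le) hx.le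
    rw [mul_inv_cancel₀ hx.ne'] at this
    nlinarith
  · rw [abs_of_nonneg (Real.log_nonneg h1)]
    nlinarith [Real.log_le_self hx.le]

/-- Unless `z` is `0` or `1`, the function `z(c)` itself omits `0` and `1`, so Landau's inequality
applies; `x |log x| ≤ 1 + x²` makes the bound uniform down to `0`. -/
theorem norm_tangentVector_le (hh : IsNormalizedHolomorphicMotion E h) {z c : ℂ} {R : ℝ}
    (hz : (z : OnePoint ℂ) ∈ E) (hc : ‖c‖ < 1) (hR : ‖movingPoint h z c‖ ≤ R) :
    ‖tangentVector h z c‖ * (1 - ‖c‖ ^ 2) ≤ 2 * (1 + R ^ 2) + 1296 * R := by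
  have hR0 : 0 ≤ R := (norm_nonneg _).trans hR
  by_cases h0 : z = 0
  · rw [h0, tangentVector_eq_zero hc fun c hc => movingPoint_zero_left hh hc, norm_zero, zero_mul]
    positivity
  by_cases h1 : z = 1
  · rw [h1, tangentVector_eq_zero hc fun c hc => movingPoint_one_left hh hc, norm_zero, zero_mul]
    positivity
  have hcb : c ∈ Metric.ball (0 : ℂ) 1 := by simpa using hc
  have n0 : ∀ c ∈ Metric.ball (0 : ℂ) 1, movingPoint h z c ≠ 0 := fun c hc => by
    have hc1 : ‖c‖ < 1 := by simpa using hc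
    have := movingPoint_ne hh hz hh.zero_mem hc1 h0
    rwa [movingPoint_zero_left hh hc1] at this
  have n1 : ∀ c ∈ Metric.ball (0 : ℂ) 1, movingPoint h z c ≠ 1 := fun c hc => by
    have hc1 : ‖c‖ < 1 := by simpa using hc
    have := movingPoint_ne hh hz hh.one_mem hc1 h1
    rwa [movingPoint_one_left hh hc1] at this
  have hl := landau (analyticOnNhd_movingPoint hh hz) n0 n1 hc
  have hx := mul_abs_log_le (norm_pos_iff.2 (n0 c hcb))
  have hsq : ‖movingPoint h z c‖ ^ 2 ≤ R ^ 2 := pow_le_pow_left₀ (norm_nonneg _) hR 2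
  refine hl.trans ?_
  linarith

/-- With `d = z₂(c) - z₁(c)`, `b = w - z₁(c)` and `g = d/b`, one has `V₂ - V₁ = b g' - d V₁ / b`.
Landau's inequality bounds `|b g'|` with leading term `2|d| |log |d||`. Since `1/2 ≤ |b| ≤ R + 1`,
all the rest is `O(|d|)`. -/
theorem norm_tangentVector_sub_le (hh : IsNormalizedHolomorphicMotion E h) {z₁ z₂ c : ℂ} {R : ℝ}
    (hz₁ : (z₁ : OnePoint ℂ) ∈ E) (hz₂ : (z₂ : OnePoint ℂ) ∈ E) (hc : ‖c‖ < 1) (h12 : z₁ ≠ z₂)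
    (hR : ‖movingPoint h z₁ c‖ ≤ R) :
    ‖tangentVector h z₂ c - tangentVector h z₁ c‖ * (1 - ‖c‖ ^ 2) ≤
      ‖movingPoint h z₂ c - movingPoint h z₁ c‖ *
        (2 * |Real.log ‖movingPoint h z₂ c - movingPoint h z₁ c‖| +
          (2 * (R + 1) + 1296 + 2 * (2 * (1 + R ^ 2) + 1296 * R))) := by
  have hR0 : 0 ≤ R := (norm_nonneg _).trans hR
  obtain ⟨w, hw, hfix, hw1, hfar⟩ := exists_fixed_far hh (movingPoint h z₁ c)
  have hcb : c ∈ Metric.ball (0 : ℂ) 1 := by simpa using hc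
  have hV := norm_tangentVector_le hh hz₁ hc hR
  have hc2 : 0 ≤ 1 - ‖c‖ ^ 2 := by nlinarith [norm_nonneg c]
  have h1w : z₁ ≠ w := by
    rintro rfl
    rw [hfix c hc, sub_self, norm_zero] at hfar
    norm_num at hfar
  set g : ℂ → ℂ := fun c => (movingPoint h z₂ c - movingPoint h z₁ c) /
      (movingPoint h w c - movingPoint h z₁ c) with hg
  have hland : ‖deriv g c‖ * (1 - ‖c‖ ^ 2) ≤ 2 * ‖g c‖ * (|Real.log ‖g c‖| + 648) := by
    -- Here `w` is chosen far from `z₁(c)` only, so it may be `z₂`; then `g` is constantly `1` near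
    -- `c`.
    by_cases h2w : z₂ = w
    · have : g =ᶠ[𝓝 c] fun _ => 1 := by
        filter_upwards [Metric.isOpen_ball.mem_nhds hcb] with x hx
        rw [hg, h2w]
        exact div_self (sub_ne_zero.2 (movingPoint_ne hh hz₁ hw (by simpa using hx) h1w).symm)
      rw [this.deriv_eq, deriv_const, norm_zero, zero_mul]
      positivity
    · obtain ⟨a, b, d⟩ := movingPoint_ratio hh hz₁ hz₂ hw h12 h1w h2w hg
      exact landau a b d hc
  have dw : HasDerivAt (movingPoint h w) 0 c := by
    have := hasDerivAt_movingPoint hh hw hc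
    rwa [tangentVector_eq_zero hc hfix] at this
  have d1 := hasDerivAt_movingPoint hh hz₁ hc
  have d2 := hasDerivAt_movingPoint hh hz₂ hc
  have hb : movingPoint h w c - movingPoint h z₁ c ≠ 0 :=
    sub_ne_zero.2 (movingPoint_ne hh hz₁ hw hc h1w).symm
  have dg : deriv g c = _ := ((d2.sub d1).div (dw.sub d1) hb).deriv
  have hd : movingPoint h z₂ c - movingPoint h z₁ c ≠ 0 :=
    sub_ne_zero.2 (movingPoint_ne hh hz₁ hz₂ hc h12).symm
  simp only [Pi.sub_apply] at dg
  have hgc : g c = (movingPoint h z₂ c - movingPoint h z₁ c) /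
      (movingPoint h w c - movingPoint h z₁ c) := rfl
  rw [hfix c hc] at dg hb hgc
  have hbR : ‖w - movingPoint h z₁ c‖ ≤ R + 1 := (norm_sub_le _ _).trans (by linarith)
  generalize movingPoint h z₂ c - movingPoint h z₁ c = d at *
  generalize w - movingPoint h z₁ c = b at *
  generalize tangentVector h z₁ c = V₁ at *
  generalize tangentVector h z₂ c = V₂ at *
  have hbp : 0 < ‖b‖ := norm_pos_iff.2 hb
  have hdp : 0 < ‖d‖ := norm_pos_iff.2 hd
  have hVeq : V₂ - V₁ = b * deriv g c - d * V₁ / b := by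
    rw [dg]; field_simp; ring
  have hlogb : |Real.log ‖b‖| ≤ R + 1 := by
    rw [abs_le]
    constructor
    · have := Real.log_le_log (by norm_num) hfar
      rw [one_div, Real.log_inv] at this
      linarith [Real.log_two_lt_d9]
    · linarith [Real.log_le_sub_one_of_pos hbp]
  have hlogg : |Real.log ‖g c‖| ≤ |Real.log ‖d‖| + (R + 1) := by
    rw [hgc, norm_div, Real.log_div hdp.ne' hbp.ne']
    exact (abs_sub _ _).trans (by linarith)
  have e1 : ‖b‖ * ‖g c‖ = ‖d‖ := by
    rw [hgc, norm_div, mul_div_cancel₀ _ hbp.ne']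
  have e2 : ‖d * V₁ / b‖ ≤ 2 * ‖d‖ * ‖V₁‖ := by
    rw [norm_div, norm_mul, div_le_iff₀ hbp]
    nlinarith [mul_nonneg hdp.le (norm_nonneg V₁)]
  have e3 : ‖V₂ - V₁‖ ≤ ‖b‖ * ‖deriv g c‖ + 2 * ‖d‖ * ‖V₁‖ := by
    rw [hVeq]
    exact (norm_sub_le _ _).trans (by rw [norm_mul]; linarith)
  calc _ ≤ (‖b‖ * ‖deriv g c‖ + 2 * ‖d‖ * ‖V₁‖) * (1 - ‖c‖ ^ 2) :=
        mul_le_mul_of_nonneg_right e3 hc2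
    _ = ‖b‖ * (‖deriv g c‖ * (1 - ‖c‖ ^ 2)) + 2 * ‖d‖ * (‖V₁‖ * (1 - ‖c‖ ^ 2)) := by ring
    _ ≤ ‖b‖ * (2 * ‖g c‖ * (|Real.log ‖d‖| + (R + 1) + 648)) +
        2 * ‖d‖ * (2 * (1 + R ^ 2) + 1296 * R) := by
      refine add_le_add (mul_le_mul_of_nonneg_left (hland.trans ?_) hbp.le)
        (mul_le_mul_of_nonneg_left hV (by positivity))
      exact mul_le_mul_of_nonneg_left (by linarith) (by positivity)
    _ = 2 * (‖b‖ * ‖g c‖) * (|Real.log ‖d‖| + (R + 1) + 648) +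
        2 * ‖d‖ * (2 * (1 + R ^ 2) + 1296 * R) := by ring
    _ = _ := by rw [e1]; ring

theorem exists_unit_mul (c : ℂ) : ∃ e : ℂ, ‖e‖ = 1 ∧ (‖c‖ : ℂ) * e = c := by
  by_cases hc : c = 0
  · exact ⟨1, by simp, by simp [hc]⟩
  · have : (‖c‖ : ℂ) ≠ 0 := by simpa using hc
    exact ⟨c / ‖c‖, by simp [hc], mul_div_cancel₀ _ this⟩

/-- Schottky's theorem for `z(c)` along the radius from `0` to `c`. -/
theorem norm_movingPoint_le (hh : IsNormalizedHolomorphicMotion E h) {z c : ℂ} {r R : ℝ}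
    (hz : (z : OnePoint ℂ) ∈ E) (hc : ‖c‖ ≤ r) (hr : r < 1) (hR : ‖z‖ ≤ R) :
    ‖movingPoint h z c‖ ≤ Real.exp ((1 + r) / (1 - r) * (|Real.log R| + 649)) := by
  have hr0 : 0 ≤ r := (norm_nonneg c).trans hc
  have hc1 : ‖c‖ < 1 := hc.trans_lt hr
  have hr1 : 0 < 1 - r := by linarith
  have hone : 1 ≤ Real.exp ((1 + r) / (1 - r) * (|Real.log R| + 649)) :=
    Real.one_le_exp (by positivity)
  by_cases h0 : z = 0
  · rw [h0, movingPoint_zero_left hh hc1, norm_zero]; linarith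
  by_cases h1 : z = 1
  · rwa [h1, movingPoint_one_left hh hc1, norm_one]
  have n0 : ∀ c ∈ Metric.ball (0 : ℂ) 1, movingPoint h z c ≠ 0 := fun c hc => by
    have hc1 : ‖c‖ < 1 := by simpa using hc
    have := movingPoint_ne hh hz hh.zero_mem hc1 h0
    rwa [movingPoint_zero_left hh hc1] at this
  have n1 : ∀ c ∈ Metric.ball (0 : ℂ) 1, movingPoint h z c ≠ 1 := fun c hc => by
    have hc1 : ‖c‖ < 1 := by simpa using hc
    have := movingPoint_ne hh hz hh.one_mem hc1 h1
    rwa [movingPoint_one_left hh hc1] at this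
  obtain ⟨e, he, hce⟩ := exists_unit_mul c
  have key := schottky (analyticOnNhd_movingPoint hh hz) n0 n1 he (a := 0) (by norm_num)
    (norm_nonneg c) hc1
  simp only [Complex.ofReal_zero, zero_mul, hce, movingPoint_zero_right hh hz, add_zero, sub_zero,
    div_one] at key
  have hm : max (Real.log ‖z‖) 0 ≤ |Real.log R| :=
    max_le ((Real.log_le_log (norm_pos_iff.2 h0) hR).trans (le_abs_self _)) (abs_nonneg _)
  have hq : (1 + ‖c‖) / (1 - ‖c‖) ≤ (1 + r) / (1 - r) :=
    div_le_div₀ (by linarith) (by linarith) hr1 (by linarith)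
  have := mul_le_mul hq (add_le_add_left hm 649)
    (by linarith [le_max_right (Real.log ‖z‖) 0]) (by positivity)
  rw [← Real.log_le_iff_le_exp (norm_pos_iff.2 (n0 c (by simpa using hc1)))]
  linarith

theorem norm_movingPoint_sub_le (hh : IsNormalizedHolomorphicMotion E h) {z₁ z₂ c : ℂ} {R : ℝ}
    (hz₁ : (z₁ : OnePoint ℂ) ∈ E) (hz₂ : (z₂ : OnePoint ℂ) ∈ E) (hc : ‖c‖ < 1)
    (hR₁ : ‖movingPoint h z₁ c‖ ≤ R) (hR₂ : ‖movingPoint h z₂ c‖ ≤ R) :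
    ‖movingPoint h z₂ c - movingPoint h z₁ c‖ ≤
      4 * (R + 1) * Real.exp 649 * ‖z₂ - z₁‖ ^ ((1 - ‖c‖) / (1 + ‖c‖)) := by
  have hR0 : 0 ≤ R := (norm_nonneg _).trans hR₁
  have hc0 := norm_nonneg c
  have hcp : 0 < 1 - ‖c‖ := by linarith
  set α : ℝ := (1 - ‖c‖) / (1 + ‖c‖) with hα
  have hα0 : 0 < α := by positivity
  have hα1 : α ≤ 1 := (div_le_one (by positivity)).2 (by linarith)
  have hE : 1 ≤ Real.exp 649 := Real.one_le_exp (by norm_num)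
  have hdist : ‖movingPoint h z₂ c - movingPoint h z₁ c‖ ≤ 2 * R :=
    (norm_sub_le _ _).trans (by linarith)
  by_cases h12 : z₁ = z₂
  · rw [h12, sub_self, norm_zero]; positivity
  have half : ∀ x : ℝ, 0 ≤ x → x ^ α ≤ 2 * (x / 2) ^ α := fun x hx => by
    have : (2 : ℝ) ^ α ≤ 2 := by
      simpa using Real.rpow_le_rpow_of_exponent_le (x := 2) (by norm_num) hα1
    calc x ^ α = (2 * (x / 2)) ^ α := by congr 1; ring
      _ = 2 ^ α * (x / 2) ^ α := Real.mul_rpow (by norm_num) (by positivity)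
      _ ≤ _ := mul_le_mul_of_nonneg_right this (by positivity)
  -- For starting points at least `1/2` apart the trivial bound `2R` is enough. Otherwise a `w` at
  -- distance at least `1/2` from `z₁` also differs from `z₂`.
  rcases le_or_gt (1 / 2) ‖z₂ - z₁‖ with hbig | hsmall
  · have h2 : 1 ≤ 2 * ‖z₂ - z₁‖ ^ α := by
      have e1 := half 1 (by norm_num)
      have e2 : (1 / 2 : ℝ) ^ α ≤ ‖z₂ - z₁‖ ^ α :=
        Real.rpow_le_rpow (by norm_num) hbig hα0.le
      rw [Real.one_rpow] at e1
      linarith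
    calc _ ≤ 2 * R * 1 * 1 := by linarith
      _ ≤ 2 * (R + 1) * Real.exp 649 * (2 * ‖z₂ - z₁‖ ^ α) := by gcongr; linarith
      _ = _ := by ring
  -- Here `w` is far from the starting point `z₁`, not from `z₁(c)`: what is needed is `|g 0| ≤ 2
  -- |z₂ - z₁|`, while at `c` the upper bound `|w - z₁(c)| ≤ R + 1` suffices.
  obtain ⟨w, hw, hfix, hw1, hfar⟩ := exists_fixed_far hh z₁
  have h1w : z₁ ≠ w := by
    rintro rfl
    rw [sub_self, norm_zero] at hfar
    norm_num at hfar
  have h2w : z₂ ≠ w := by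
    rintro rfl
    exact hsmall.not_ge hfar
  set g : ℂ → ℂ := fun c => (movingPoint h z₂ c - movingPoint h z₁ c) /
      (movingPoint h w c - movingPoint h z₁ c) with hg
  obtain ⟨hga, hg0, hg1⟩ := movingPoint_ratio hh hz₁ hz₂ hw h12 h1w h2w hg
  obtain ⟨e, he, hce⟩ := exists_unit_mul c
  -- In direction `-e` the parameter `-‖c‖` is the point `c` and `0` is the centre, so this bounds
  -- `1/g` at `0` by its value at `c`, with growth factor `α⁻¹`.
  have key := schottky (f := fun x => (g x)⁻¹) (hga.inv hg0) (fun x hx => inv_ne_zero (hg0 x hx))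
    (fun x hx => by simpa using hg1 x hx) (e := -e) (by simpa using he) (a := -‖c‖) (b := 0)
    (by linarith) (by linarith) (by norm_num)
  have hg0p : 0 < ‖g 0‖ := norm_pos_iff.2 (hg0 0 (by simp))
  have hgcp : 0 < ‖g c‖ := norm_pos_iff.2 (hg0 c (by simpa using hc))
  have hq : (1 + (0 : ℝ)) / (1 - 0) / ((1 + -‖c‖) / (1 - -‖c‖)) = α⁻¹ := by
    rw [hα, sub_neg_eq_add, ← sub_eq_add_neg]; simp
  rw [hq] at key
  simp only [Complex.ofReal_zero, zero_mul, Complex.ofReal_neg, neg_mul_neg, hce, norm_inv,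
    Real.log_inv] at key
  rw [← div_eq_inv_mul, le_div_iff₀ hα0] at key
  have hm : α * -Real.log ‖g 0‖ ≤ max (-Real.log ‖g c‖) 0 + 649 := by nlinarith
  have hpow : ‖g 0‖ ^ α = Real.exp (α * Real.log ‖g 0‖) := by
    rw [Real.rpow_def_of_pos hg0p, mul_comm]
  have hg0le : ‖g 0‖ ^ α ≤ 2 * ‖z₂ - z₁‖ ^ α := by
    have : ‖g 0‖ ≤ 2 * ‖z₂ - z₁‖ := by
      simp only [hg, movingPoint_zero_right hh hz₁, movingPoint_zero_right hh hz₂,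
        hfix 0 (by simp), norm_div]
      rw [div_le_iff₀ (by linarith)]
      nlinarith [norm_nonneg (z₂ - z₁)]
    refine (Real.rpow_le_rpow hg0p.le this hα0.le).trans ((half _ (by positivity)).trans ?_)
    rw [mul_div_cancel_left₀ _ two_ne_zero]
  have hdle : ‖movingPoint h z₂ c - movingPoint h z₁ c‖ ≤ (R + 1) * ‖g c‖ := by
    have hb : 0 < ‖w - movingPoint h z₁ c‖ := by
      have := movingPoint_ne hh hz₁ hw hc h1w
      rw [hfix c hc] at this
      exact norm_pos_iff.2 (sub_ne_zero.2 this.symm)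
    have hbR : ‖w - movingPoint h z₁ c‖ ≤ R + 1 := (norm_sub_le _ _).trans (by linarith)
    simp only [hg, hfix c hc, norm_div]
    rw [mul_div_assoc', le_div_iff₀ hb, mul_comm]
    exact mul_le_mul_of_nonneg_right hbR (norm_nonneg _)
  -- The truncation at `1` reflects the `max` with `0` in Schottky's bound. It is harmless because
  -- the distance at `c` is also at most `2R`.
  have hmin : min ‖g c‖ 1 ≤ Real.exp 649 * ‖g 0‖ ^ α := by
    rw [hpow, ← Real.exp_add]
    rcases le_total (-Real.log ‖g c‖) 0 with hl | hl
    · rw [max_eq_right hl] at hm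
      exact (min_le_right _ _).trans (Real.one_le_exp (by linarith))
    · rw [max_eq_left hl] at hm
      refine (min_le_left _ _).trans ?_
      rw [← Real.log_le_iff_le_exp hgcp]
      linarith
  have hfin : ‖movingPoint h z₂ c - movingPoint h z₁ c‖ ≤ 2 * (R + 1) * min ‖g c‖ 1 := by
    rcases le_total ‖g c‖ 1 with hl | hl
    · rw [min_eq_left hl]; nlinarith
    · rw [min_eq_right hl]; linarith
  calc _ ≤ 2 * (R + 1) * min ‖g c‖ 1 := hfin
    _ ≤ 2 * (R + 1) * (Real.exp 649 * (2 * ‖z₂ - z₁‖ ^ α)) := by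
      refine mul_le_mul_of_nonneg_left (hmin.trans ?_) (by positivity)
      exact mul_le_mul_of_nonneg_left hg0le (by positivity)
    _ = _ := by ring

end motion

/-! ### Choice of constants and conclusion -/

/-- The constants `M` and `C` depend on `r` and `R` only, not on the motion. -/
theorem theorem6p5 (r R : ℝ) (hr0 : 0 < r) (hr1 : r < 1) (hR : 0 < R) :
    ∃ M C : ℝ, 0 < M ∧ 0 < C ∧
      ∀ (E : Set (OnePoint ℂ)) (h : ℂ → OnePoint ℂ → OnePoint ℂ),
        IsNormalizedHolomorphicMotion E h →
        ∀ z₁ z₂ c : ℂ, (z₁ : OnePoint ℂ) ∈ E → (z₂ : OnePoint ℂ) ∈ E → ‖c‖ ≤ r →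
          -- the `ε log ε` estimate of the tangent vectors, with `ε = M / log (1 / δ)`
          (∀ δ : ℝ, 0 < δ → δ < 1 →
            ‖movingPoint h z₁ c‖ ≤ R → ‖movingPoint h z₂ c‖ ≤ R →
            ‖movingPoint h z₂ c - movingPoint h z₁ c‖ < δ →
            ‖tangentVector h z₂ c - tangentVector h z₁ c‖ ≤
              (2 + M / Real.log (1 / δ)) / (1 - ‖c‖ ^ 2) *
                ‖movingPoint h z₂ c - movingPoint h z₁ c‖ *
                Real.log (1 / ‖movingPoint h z₂ c - movingPoint h z₁ c‖)) ∧
          -- the distance estimate for moving points that lie in `|z| ≤ R` at the parameter `c`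
          (‖movingPoint h z₁ c‖ ≤ R → ‖movingPoint h z₂ c‖ ≤ R →
            ‖movingPoint h z₂ c - movingPoint h z₁ c‖ ≤
              C * ‖z₂ - z₁‖ ^ ((1 - ‖c‖) / (1 + ‖c‖))) ∧
          -- the same for points that start in `|z| ≤ R`: Hölder continuity of `h(c, ·)` there
          (‖z₁‖ ≤ R → ‖z₂‖ ≤ R →
            ‖movingPoint h z₂ c - movingPoint h z₁ c‖ ≤
              C * ‖z₂ - z₁‖ ^ ((1 - ‖c‖) / (1 + ‖c‖))) := by

  set K : ℝ := 2 * (R + 1) + 1296 + 2 * (2 * (1 + R ^ 2) + 1296 * R) with hK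
  set S : ℝ := Real.exp ((1 + r) / (1 - r) * (|Real.log R| + 649)) with hS
  have hS0 : 0 < S := Real.exp_pos _
  have hK0 : 0 < K := by positivity
  -- `C` adds the constants for the radii `R` (second part) and `S` (third part), where `S` bounds
  -- at parameter `c` the points that start in `|z| ≤ R`.
  refine ⟨K, 4 * (R + 1) * Real.exp 649 + 4 * (S + 1) * Real.exp 649, hK0, by positivity, ?_⟩
  intro E h hh z₁ z₂ c hz₁ hz₂ hcr
  have hc : ‖c‖ < 1 := hcr.trans_lt hr1
  refine ⟨fun δ hδ0 hδ1 hR₁ _ hlt => ?_, fun hR₁ hR₂ => ?_, fun hR₁ hR₂ => ?_⟩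
  · by_cases h12 : z₁ = z₂
    · simp [h12]
    have hd : 0 < ‖movingPoint h z₂ c - movingPoint h z₁ c‖ :=
      norm_pos_iff.2 (sub_ne_zero.2 (movingPoint_ne hh hz₁ hz₂ hc h12).symm)
    have key := norm_tangentVector_sub_le hh hz₁ hz₂ hc h12 hR₁
    have hc2 : 0 < 1 - ‖c‖ ^ 2 := by nlinarith [norm_nonneg c]
    rw [← hK, abs_of_nonpos (Real.log_nonpos hd.le (by linarith)), ← Real.log_inv,
      ← one_div] at key
    generalize ‖movingPoint h z₂ c - movingPoint h z₁ c‖ = d at *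
    have hlδ : 0 < Real.log (1 / δ) := Real.log_pos ((one_lt_div hδ0).2 hδ1)
    have hld : Real.log (1 / δ) ≤ Real.log (1 / d) :=
      Real.log_le_log (by positivity) (one_div_le_one_div_of_le hd hlt.le)
    -- The additive error `K` is absorbed into the logarithm, which is what produces `ε = K / log
    -- (1/δ)`.
    have hKl : K ≤ K / Real.log (1 / δ) * Real.log (1 / d) := by
      rw [div_mul_eq_mul_div, le_div_iff₀ hlδ]
      exact mul_le_mul_of_nonneg_left hld hK0.le
    rw [div_mul_eq_mul_div, div_mul_eq_mul_div, le_div_iff₀ hc2]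
    refine key.trans ?_
    have := mul_le_mul_of_nonneg_left hKl hd.le
    linarith
  · refine (norm_movingPoint_sub_le hh hz₁ hz₂ hc hR₁ hR₂).trans
      (mul_le_mul_of_nonneg_right (le_add_of_nonneg_right (by positivity)) (by positivity))
  · refine (norm_movingPoint_sub_le hh hz₁ hz₂ hc (norm_movingPoint_le hh hz₁ hcr hr1 hR₁)
      (norm_movingPoint_le hh hz₂ hcr hr1 hR₂)).trans
      (mul_le_mul_of_nonneg_right (le_add_of_nonneg_left (by positivity)) (by positivity))
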